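/- **Polyadic algebras.** Let $\gamma$ be an ordinal. A *polyadic algebra of dimension $\gamma$* (a $\mathsf{PA}_\gamma$) is a Boolean algebra with unary operations $\mathsf c_{(\Gamma)}$ for all $\Gamma\subseteq\gamma$ and $\mathsf s_\tau$ for all maps $\tau:\gamma\to\gamma$ such that, for all $\Gamma,\Delta\subseteq\gamma$, all $\sigma,\tau:\gamma\to\gamma$ and all elements $x,y$: 1. $\mathsf c_{(\Gamma)}0=0$, $\;x\le \mathsf c_{(\Gamma)}x$, $\;\mathsf c_{(\Gamma)}(x\cdot \mathsf c_{(\Gamma)}y)=\mathsf c_{(\Gamma)}x\cdot \mathsf c_{(\Gamma)}y$, $\;\mathsf c_{(\emptyset)}x=x$, $\;\mathsf c_{(\Gamma)}\mathsf c_{(\Delta)}x=\mathsf c_{(\Gamma\cup\Delta)}x$; 2. $\mathsf s_\tau$ is a Boolean endomorphism, $\;\mathsf s_{\mathrm{Id}}x=x$, $\;\mathsf s_{\sigma\circ\tau}x=\mathsf s_\sigma \mathsf s_\tau x$; 3. if $\sigma$ and $\tau$ agree on $\gamma\setminus\Gamma$, then $\mathsf s_\sigma \mathsf c_{(\Gamma)}x=\mathsf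 s_\tau \mathsf c_{(\Gamma)}x$; 4. if $\Delta=\tau^{-1}(\Gamma)$ and $\tau$ is one-to-one on $\Delta$, then $\mathsf c_{(\Gamma)}\mathsf s_\tau x=\mathsf s_\tau \mathsf c_{(\Delta)}x$. Homomorphisms preserve all these operations; a monomorphism (embedding) is an injective homomorphism. For $X\subseteq \mathfrak B$, $\mathfrak{Sg}^{\mathfrak B}X$ is the subalgebra of $\mathfrak B$ generated by $X$. **Neat reducts.** For $\alpha<\beta$ and $\mathfrak B\in\mathsf{PA}_\beta$, the neat reduct $\mathfrak{Nr}_\alpha\mathfrak B\in \mathsf{PA}_\alpha$ is the Boolean subalgebra of all $x\in \mathfrak B$ with $\mathsf c_{(\beta\setminus\alpha)}x=x$, with the operations $\mathsf c_{(\Gamma)}$ of $\mathfrak B$ for $\Gamma\subseteq\alpha$, and with $\mathsf s_\sigma$, for $\sigma:\alpha\to\alpha$, given by $\mathsf s_{\bar\sigma}$ in $\mathfrak B$, where $\bar\sigma=\sigma\cup \mathrm{Id}_{\beta\setminus\alpha}$. **Statement.** Let $\alpha<\beta$ be infinite ordinals, let $\mathfrak A,\mathfrak A'\in\mathsf{PA}_\alpha$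 and $\mathfrak B,\mathfrak B'\in\mathsf{PA}_\beta$, and let $e_A:\mathfrak A\to\mathfrak{Nr}_\alpha\mathfrak B$ and $e_{A'}:\mathfrak A'\to\mathfrak{Nr}_\alpha\mathfrak B'$ be embeddings such that $\mathfrak{Sg}^{\mathfrak B}e_A(A)=\mathfrak B$ and $\mathfrak{Sg}^{\mathfrak B'}e_{A'}(A')=\mathfrak B'$. Then for every monomorphism $i:\mathfrak A\to\mathfrak A'$ there is a monomorphism $\bar i:\mathfrak B\to\mathfrak B'$ such that $\bar i\circ e_A=e_{A'}\circ i$. -/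

import Mathlib

/-- A polyadic algebra (without equality) whose set of dimensions is `I`, on a Boolean algebra `A`:
a cylindrification `cyl Γ` for every `Γ ⊆ I`, finite or infinite, and a substitution `subst τ` for
every transformation `τ` of `I`, finite or infinite, subject to Halmos' axioms. -/
class PolyadicAlgebra (I : Type*) (A : Type*) [BooleanAlgebra A] where
  /-- The cylindrification `c_(Γ)`. -/
  cyl : Set I → A → A
  /-- The substitution `s_τ`. -/
  subst : (I → I) → A → A
  cyl_bot : ∀ Γ : Set I, cyl Γ ⊥ = ⊥
  le_cyl : ∀ (Γ : Set I) (x : A), x ≤ cyl Γ x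
  cyl_inf_cyl : ∀ (Γ : Set I) (x y : A), cyl Γ (x ⊓ cyl Γ y) = cyl Γ x ⊓ cyl Γ y
  cyl_empty : ∀ x : A, cyl ∅ x = x
  cyl_cyl : ∀ (Γ Δ : Set I) (x : A), cyl Γ (cyl Δ x) = cyl (Γ ∪ Δ) x
  subst_sup : ∀ (τ : I → I) (x y : A), subst τ (x ⊔ y) = subst τ x ⊔ subst τ y
  subst_inf : ∀ (τ : I → I) (x y : A), subst τ (x ⊓ y) = subst τ x ⊓ subst τ y
  subst_compl : ∀ (τ : I → I) (x : A), subst τ xᶜ = (subst τ x)ᶜ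
  subst_id : ∀ x : A, subst id x = x
  subst_comp : ∀ (σ τ : I → I) (x : A), subst (σ ∘ τ) x = subst σ (subst τ x)
  subst_cyl_congr : ∀ (σ τ : I → I) (Γ : Set I) (x : A),
    Set.EqOn σ τ Γᶜ → subst σ (cyl Γ x) = subst τ (cyl Γ x)
  cyl_subst : ∀ (τ : I → I) (Γ Δ : Set I) (x : A),
    τ ⁻¹' Γ = Δ → Set.InjOn τ Δ → cyl Γ (subst τ x) = subst τ (cyl Δ x)

/-- A homomorphism of polyadic algebras: a Boolean homomorphism that commutes with all
cylindrifications and all substitutions. A monomorphism (embedding) is an injective one. -/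
structure PolyadicHom (I : Type*) (A B : Type*) [BooleanAlgebra A] [BooleanAlgebra B]
    [PolyadicAlgebra I A] [PolyadicAlgebra I B] extends BoundedLatticeHom A B where
  map_cyl' : ∀ (Γ : Set I) (x : A),
    toFun (PolyadicAlgebra.cyl Γ x) = PolyadicAlgebra.cyl Γ (toFun x)
  map_subst' : ∀ (τ : I → I) (x : A),
    toFun (PolyadicAlgebra.subst τ x) = PolyadicAlgebra.subst τ (toFun x)

instance PolyadicHom.instFunLike (I : Type*) (A B : Type*) [BooleanAlgebra A] [BooleanAlgebra B]
    [PolyadicAlgebra I A] [PolyadicAlgebra I B] : FunLike (PolyadicHom I A B) A B where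
  coe f := f.toFun
  coe_injective f g h := by
    obtain ⟨⟨⟨⟨f, _⟩, _⟩, _, _⟩, _, _⟩ := f
    obtain ⟨⟨⟨⟨g, _⟩, _⟩, _, _⟩, _, _⟩ := g
    congr

/-- A subuniverse of a polyadic algebra: closed under all the operations. -/
structure PolyadicSubalgebra (I : Type*) (B : Type*) [BooleanAlgebra B] [PolyadicAlgebra I B]
    extends BooleanSubalgebra B where
  cyl_mem' : ∀ (Γ : Set I) {x : B}, x ∈ carrier → PolyadicAlgebra.cyl Γ x ∈ carrier
  subst_mem' : ∀ (τ : I → I) {x : B}, x ∈ carrier → PolyadicAlgebra.subst τ x ∈ carrier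

/-- The universe of the subalgebra of `B` generated by `X`. -/
def polyadicSg (I : Type*) {B : Type*} [BooleanAlgebra B] [PolyadicAlgebra I B] (X : Set B) :
    Set B :=
  {b | ∀ S : PolyadicSubalgebra I B, X ⊆ S.carrier → b ∈ S.carrier}

namespace PolyadicAlgebra

section Basic

variable {J B : Type*} [BooleanAlgebra B] [PolyadicAlgebra J B]

theorem cyl_compl_cyl (Γ : Set J) (x : B) : cyl Γ (cyl Γ x)ᶜ = (cyl Γ x)ᶜ := by
  refine le_antisymm ?_ (le_cyl _ _)
  rw [le_compl_iff_disjoint_right, disjoint_iff, ← cyl_inf_cyl, compl_inf_eq_bot, cyl_bot]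

theorem cyl_compl_of_eq {Γ : Set J} {x : B} (h : cyl Γ x = x) : cyl Γ xᶜ = xᶜ := by
  have := cyl_compl_cyl Γ x
  rwa [h] at this

theorem cyl_inf_of_eq {Γ : Set J} {x y : B} (hx : cyl Γ x = x) (hy : cyl Γ y = y) :
    cyl Γ (x ⊓ y) = x ⊓ y := by
  have := cyl_inf_cyl Γ x y
  rwa [hx, hy] at this

theorem cyl_sup_of_eq {Γ : Set J} {x y : B} (hx : cyl Γ x = x) (hy : cyl Γ y = y) :
    cyl Γ (x ⊔ y) = x ⊔ y := by
  have := cyl_compl_of_eq (cyl_inf_of_eq (cyl_compl_of_eq hx) (cyl_compl_of_eq hy))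
  rwa [compl_inf, compl_compl, compl_compl] at this

end Basic

section Extension

variable {I J : Type*} (ι : I ↪ J)

/-- The extension of a transformation `σ` of `I` to `J ⊇ I` by the identity on `J ∖ I`. -/
noncomputable def extendId (σ : I → I) : J → J := Function.extend ι (ι ∘ σ) id

theorem extendId_apply (σ : I → I) (i : I) : extendId ι σ (ι i) = ι (σ i) := by
  simp [extendId, ι.injective.extend_apply]

theorem extendId_of_notMem (σ : I → I) {j : J} (hj : j ∉ Set.range ι) : extendId ι σ j = j :=
  Function.extend_apply' _ _ _ (by simpa using hj)

theorem extendId_id : extendId ι id = id := by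
  funext j
  by_cases hj : j ∈ Set.range ι
  · obtain ⟨i, rfl⟩ := hj
    rw [extendId_apply]; rfl
  · rw [extendId_of_notMem ι _ hj]; rfl

theorem extendId_comp (σ τ : I → I) : extendId ι (σ ∘ τ) = extendId ι σ ∘ extendId ι τ := by
  funext j
  by_cases hj : j ∈ Set.range ι
  · obtain ⟨i, rfl⟩ := hj
    simp [extendId_apply]
  · simp [extendId_of_notMem ι _ hj]

theorem extendId_congr {σ τ : I → I} {Γ : Set I} (h : Set.EqOn σ τ Γᶜ) :
    Set.EqOn (extendId ι σ) (extendId ι τ) (ι '' Γ)ᶜ := by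
  intro j hjΓ
  by_cases hj : j ∈ Set.range ι
  · obtain ⟨i, rfl⟩ := hj
    rw [extendId_apply, extendId_apply, h fun hi => hjΓ ⟨i, hi, rfl⟩]
  · rw [extendId_of_notMem ι _ hj, extendId_of_notMem ι _ hj]

theorem extendId_preimage (τ : I → I) (Γ : Set I) :
    extendId ι τ ⁻¹' (ι '' Γ) = ι '' (τ ⁻¹' Γ) := by
  ext j
  by_cases hj : j ∈ Set.range ι
  · obtain ⟨i, rfl⟩ := hj
    simp [extendId_apply]
  · have h : ∀ S : Set I, j ∉ ι '' S := fun S hS => hj (Set.image_subset_range _ _ hS)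
    simp only [Set.mem_preimage, extendId_of_notMem ι _ hj, h]

theorem extendId_injOn {τ : I → I} {Δ : Set I} (h : Set.InjOn τ Δ) :
    Set.InjOn (extendId ι τ) (ι '' Δ) := by
  rintro _ ⟨a, ha, rfl⟩ _ ⟨b, hb, rfl⟩ hab
  rw [extendId_apply, extendId_apply] at hab
  rw [h ha hb (ι.injective hab)]

theorem extendId_preimage_compl_range (τ : I → I) :
    extendId ι τ ⁻¹' (Set.range ι)ᶜ = (Set.range ι)ᶜ := by
  ext j
  by_cases hj : j ∈ Set.range ι
  · obtain ⟨i, rfl⟩ := hj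
    simp [extendId_apply]
  · simp only [Set.mem_preimage, extendId_of_notMem ι _ hj]

theorem extendId_injOn_compl_range (τ : I → I) :
    Set.InjOn (extendId ι τ) (Set.range ι)ᶜ := by
  intro a ha b hb hab
  rwa [extendId_of_notMem ι _ ha, extendId_of_notMem ι _ hb] at hab

end Extension

end PolyadicAlgebra

open PolyadicAlgebra in
/-- The Boolean part of the neat reduct of the `J`-dimensional polyadic algebra `B` to the dimensions
`I ⊆ J` (the inclusion being `ι`): the elements `x` with `c_(J ∖ I) x = x`. -/
def neatReduct {I J : Type*} (ι : I ↪ J) (B : Type*) [BooleanAlgebra B] [PolyadicAlgebra J B] :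
    BooleanSubalgebra B where
  carrier := {x | cyl (Set.range ι)ᶜ x = x}
  supClosed' := fun _ hx _ hy => cyl_sup_of_eq hx hy
  infClosed' := fun _ hx _ hy => cyl_inf_of_eq hx hy
  compl_mem' := fun hx => cyl_compl_of_eq hx
  bot_mem' := cyl_bot _

open PolyadicAlgebra in
/-- The neat reduct as an `I`-dimensional polyadic algebra: `c_(Γ)` for `Γ ⊆ I` is that of `B`, and
`s_σ` for a transformation `σ` of `I` is `s_σ'` in `B`, `σ'` extending `σ` by the identity. -/
noncomputable instance neatReduct.instPolyadicAlgebra {I J : Type*} (ι : I ↪ J) (B : Type*)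
    [BooleanAlgebra B] [PolyadicAlgebra J B] : PolyadicAlgebra I (neatReduct ι B) where
  cyl Γ x := ⟨cyl (ι '' Γ) (x : B), by
    have hx : cyl (Set.range ι)ᶜ (x : B) = x := x.2
    change cyl (Set.range ι)ᶜ (cyl (ι '' Γ) (x : B)) = cyl (ι '' Γ) (x : B)
    rw [cyl_cyl, Set.union_comm, ← cyl_cyl, hx]⟩
  subst σ x := ⟨subst (extendId ι σ) (x : B), by
    have hx : cyl (Set.range ι)ᶜ (x : B) = x := x.2
    change cyl (Set.range ι)ᶜ (subst (extendId ι σ) (x : B)) = subst (extendId ι σ) (x : B)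
    rw [cyl_subst _ _ _ _ (extendId_preimage_compl_range ι σ) (extendId_injOn_compl_range ι σ),
      hx]⟩
  cyl_bot _ := Subtype.ext (cyl_bot _)
  le_cyl _ _ := le_cyl _ (_ : B)
  cyl_inf_cyl _ _ _ := Subtype.ext (cyl_inf_cyl _ _ _)
  cyl_empty x := Subtype.ext (by simp [cyl_empty])
  cyl_cyl Γ Δ x := Subtype.ext (by simp only [cyl_cyl, Set.image_union])
  subst_sup _ _ _ := Subtype.ext (subst_sup _ _ _)
  subst_inf _ _ _ := Subtype.ext (subst_inf _ _ _)
  subst_compl _ _ := Subtype.ext (subst_compl _ _)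
  subst_id x := Subtype.ext (by simp only [extendId_id, subst_id])
  subst_comp σ τ x := Subtype.ext (by simp only [extendId_comp, subst_comp])
  subst_cyl_congr _ _ _ _ h := Subtype.ext (subst_cyl_congr _ _ _ _ (extendId_congr ι h))
  cyl_subst τ Γ Δ x h hinj := Subtype.ext (cyl_subst _ _ _ _
    (by rw [extendId_preimage, h]) (extendId_injOn ι hinj))

/-- The inclusion of `α = {γ | γ < α}` in `β = {γ | γ < β}` for ordinals `α < β`. -/
def ordinalIncl {α β : Ordinal} (h : α < β) : Set.Iio α ↪ Set.Iio β :=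
  Set.embeddingOfSubset _ _ (Set.Iio_subset_Iio h.le)

/-! Regard `A` as a part of the neat reduct of `B`, with `I` the small and `J` the large set of
dimensions. The elements `s_σ a` already exhaust `B`, and all relations among them are decided
inside `A`. Indeed `s_σ a` depends only on `σ` restricted to `I`. As `I` is infinite, any two such
restrictions factor through one injection of `I` into `J` (`exists_common_factor`), so any two
elements of `B` are `s_ρ a'` and `s_ρ b'` with `a', b'` in `A` and `ρ` one-to-one on `I`. Such an
`s_ρ` is injective on the neat reduct and turns cylindrifications of `J` into cylindrifications of
`I`. Hence `s_σ a ↦ s_σ (k a)` is a well-defined embedding for every embedding `k` of `A` in a neat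
reduct. -/

namespace PolyadicHom

variable {I A B C : Type*} [BooleanAlgebra A] [BooleanAlgebra B] [BooleanAlgebra C]
  [PolyadicAlgebra I A] [PolyadicAlgebra I B] [PolyadicAlgebra I C]

theorem map_cyl (f : PolyadicHom I A B) (Γ : Set I) (x : A) :
    f (PolyadicAlgebra.cyl Γ x) = PolyadicAlgebra.cyl Γ (f x) :=
  f.map_cyl' Γ x

theorem map_subst (f : PolyadicHom I A B) (τ : I → I) (x : A) :
    f (PolyadicAlgebra.subst τ x) = PolyadicAlgebra.subst τ (f x) :=
  f.map_subst' τ x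

instance instBoundedLatticeHomClass : BoundedLatticeHomClass (PolyadicHom I A B) A B where
  map_sup f := f.map_sup'
  map_inf f := f.map_inf'
  map_top f := f.map_top'
  map_bot f := f.map_bot'

/-- The composition of homomorphisms of polyadic algebras. -/
def comp (g : PolyadicHom I B C) (f : PolyadicHom I A B) : PolyadicHom I A C where
  toBoundedLatticeHom := g.toBoundedLatticeHom.comp f.toBoundedLatticeHom
  map_cyl' Γ x := (congrArg g (f.map_cyl Γ x)).trans (g.map_cyl Γ (f x))
  map_subst' τ x := (congrArg g (f.map_subst τ x)).trans (g.map_subst τ (f x))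

end PolyadicHom

namespace PolyadicAlgebra

section Basic

variable {J B : Type*} [BooleanAlgebra B] [PolyadicAlgebra J B]

theorem subst_bot (τ : J → J) : subst τ (⊥ : B) = ⊥ := by
  have h := subst_inf τ (⊥ : B) ⊥ᶜ
  rwa [subst_compl, inf_compl_self, inf_compl_self] at h

theorem subst_top (τ : J → J) : subst τ (⊤ : B) = ⊤ := by
  rw [← compl_bot, subst_compl, subst_bot]

end Basic

/-! ### Substitutions acting on elements of a neat reduct -/

section NeatReduct

variable {I J B : Type*} [BooleanAlgebra B] [PolyadicAlgebra J B] {ι : I ↪ J}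

theorem subst_congr_of_mem_neatReduct {σ τ : J → J} (h : σ ∘ ι = τ ∘ ι) (x : neatReduct ι B) :
    subst σ (x : B) = subst τ (x : B) := by
  have hx : cyl (Set.range ι)ᶜ (x : B) = x := x.2
  rw [← hx]
  refine subst_cyl_congr _ _ _ _ ?_
  rw [compl_compl]
  rintro _ ⟨i, rfl⟩
  exact congrFun h i

theorem subst_eq_subst_coe_subst {σ ρ : J → J} {f : I → I} (h : σ ∘ ι = ρ ∘ ι ∘ f)
    (x : neatReduct ι B) :
    subst σ (x : B) = subst ρ ((subst f x : neatReduct ι B) : B) := by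
  change _ = subst ρ (subst (extendId ι f) (x : B))
  rw [← subst_comp]
  refine subst_congr_of_mem_neatReduct (h.trans ?_) x
  funext i
  simp [extendId_apply]

/-- Substitution along a left inverse of `ρ` on `I` undoes `s_ρ`; values off the range of `ρ ∘ ι`
play no role. -/
theorem subst_injective_of_injective_comp {ρ : J → J} (hρ : Function.Injective (ρ ∘ ι)) :
    Function.Injective fun x : neatReduct ι B => subst ρ (x : B) := by
  have key (x : neatReduct ι B) :
      subst (Function.extend (ρ ∘ ι) ι id) (subst ρ (x : B)) = x := by
    rw [← subst_comp]
    refine (subst_congr_of_mem_neatReduct (τ := id) ?_ x).trans (subst_id _)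
    funext i
    exact hρ.extend_apply ι id i
  intro x y hxy
  refine Subtype.ext ?_
  rw [← key x, ← key y]
  exact congrArg _ hxy

/-- The axiom `cyl_subst` needs injectivity on the whole preimage of `Γ`. Off `I`, `ρ` may be
changed freely, so it is sent there to a point outside `Γ`, which leaves only points of `I` in the
preimage. -/
theorem cyl_subst_of_ne_univ {ρ : J → J} (hρ : Function.Injective (ρ ∘ ι)) {Γ : Set J}
    (hΓ : Γ ≠ Set.univ) (x : neatReduct ι B) :
    cyl Γ (subst ρ (x : B)) =
      subst ρ ((cyl ((ρ ∘ ι) ⁻¹' Γ) x : neatReduct ι B) : B) := by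
  obtain ⟨j, hj⟩ := (Set.ne_univ_iff_exists_notMem Γ).1 hΓ
  have hcomp : ρ ∘ ι = Function.extend ι (ρ ∘ ι) (fun _ => j) ∘ ι := by
    funext i
    exact (ι.injective.extend_apply _ _ i).symm
  have hpre : Function.extend ι (ρ ∘ ι) (fun _ => j) ⁻¹' Γ = ι '' ((ρ ∘ ι) ⁻¹' Γ) := by
    ext k
    by_cases hk : k ∈ Set.range ι
    · obtain ⟨i, rfl⟩ := hk
      simp [ι.injective.extend_apply]
    · have h : k ∉ ι '' ((ρ ∘ ι) ⁻¹' Γ) := fun h => hk (Set.image_subset_range _ _ h)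
      rw [Set.mem_preimage, Function.extend_apply' _ _ _ hk]
      exact iff_of_false hj h
  rw [subst_congr_of_mem_neatReduct hcomp, subst_congr_of_mem_neatReduct hcomp]
  refine cyl_subst _ _ _ _ hpre ?_
  rintro _ ⟨a, -, rfl⟩ _ ⟨b, -, rfl⟩ hab
  rw [ι.injective.extend_apply, ι.injective.extend_apply] at hab
  rw [hρ hab]

theorem cyl_subst_of_injective_comp [Nontrivial J] {ρ : J → J}
    (hρ : Function.Injective (ρ ∘ ι)) (Γ : Set J) (x : neatReduct ι B) :
    cyl Γ (subst ρ (x : B)) =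
      subst ρ ((cyl ((ρ ∘ ι) ⁻¹' Γ) x : neatReduct ι B) : B) := by
  by_cases hΓ : Γ = Set.univ
  · obtain ⟨j, k, hjk⟩ := exists_pair_ne J
    -- No point lies outside `Γ` here, so `J` is split into two proper subsets.
    have h₁ : ({j} : Set J)ᶜ ≠ Set.univ := fun h => (h ▸ Set.mem_univ j : j ∈ ({j} : Set J)ᶜ) rfl
    have h₂ : ({j} : Set J) ≠ Set.univ := fun h => hjk (h ▸ Set.mem_univ k : k ∈ ({j} : Set J)).symm
    rw [hΓ, ← Set.compl_union_self {j}, ← cyl_cyl, cyl_subst_of_ne_univ hρ h₂,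
      cyl_subst_of_ne_univ hρ h₁, cyl_cyl, Set.preimage_union]
  · exact cyl_subst_of_ne_univ hρ hΓ x

end NeatReduct

/-- Two transformations factor, on an infinite set `I` of dimensions, through one injection of `I`. -/
theorem exists_common_factor {I J : Type*} [Infinite I] (ι : I ↪ J) (σ τ : J → J) :
    ∃ (ρ : J → J) (f g : I → I), Function.Injective (ρ ∘ ι) ∧
      σ ∘ ι = ρ ∘ ι ∘ f ∧ τ ∘ ι = ρ ∘ ι ∘ g := by
  -- Including `ι` keeps the range of `φ` at least as large as `I`; as `I` is infinite, the range is
  -- equinumerous with `I`, and `ρ` enumerates it.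
  let φ : I ⊕ I ⊕ I → J := Sum.elim ι (Sum.elim (σ ∘ ι) (τ ∘ ι))
  have hle : Nonempty (Set.range φ ↪ I) := by
    obtain ⟨e⟩ : Nonempty (I ⊕ I ⊕ I ≃ I) := Cardinal.eq.1 (by simp)
    exact ⟨(Function.Embedding.ofSurjective _ Set.rangeFactorization_surjective).trans
      e.toEmbedding⟩
  obtain ⟨u⟩ := hle
  let v : I ↪ Set.range φ :=
    ⟨fun i => ⟨ι i, Sum.inl i, rfl⟩, fun a b h => ι.injective (congrArg Subtype.val h)⟩
  obtain ⟨w⟩ : Nonempty (I ≃ Set.range φ) :=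
    (Function.Embedding.antisymm v u)
  have hρ (i : I) : Function.extend ι (fun i => (w i : J)) id (ι i) = w i :=
    ι.injective.extend_apply _ _ i
  refine ⟨Function.extend ι (fun i => (w i : J)) id,
    fun i => w.symm ⟨σ (ι i), Sum.inr (Sum.inl i), rfl⟩,
    fun i => w.symm ⟨τ (ι i), Sum.inr (Sum.inr i), rfl⟩, ?_, ?_, ?_⟩
  · intro a b h
    simp only [Function.comp_apply, hρ] at h
    exact w.injective (Subtype.ext h)
  · funext i
    simp [hρ]
  · funext i
    simp [hρ]

/-! ### Extending maps from `A` to the algebra it generates -/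

section Dilation

variable {I J A B B' : Type*} [Infinite I] {ι : I ↪ J}
  [BooleanAlgebra A] [BooleanAlgebra B] [BooleanAlgebra B']
  [PolyadicAlgebra I A] [PolyadicAlgebra J B] [PolyadicAlgebra J B']

/-- The same `a'` and `b'` serve `e` and `k`, being obtained from `a` and `b` by substitutions
within `A`. This is what carries relations from `B` to `B'`. -/
theorem exists_common_subst (e : PolyadicHom I A (neatReduct ι B))
    (k : PolyadicHom I A (neatReduct ι B')) (σ τ : J → J) (a b : A) :
    ∃ (ρ : J → J) (a' b' : A), Function.Injective (ρ ∘ ι) ∧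
      subst σ (e a : B) = subst ρ (e a' : B) ∧ subst τ (e b : B) = subst ρ (e b' : B) ∧
      subst σ (k a : B') = subst ρ (k a' : B') ∧ subst τ (k b : B') = subst ρ (k b' : B') := by
  obtain ⟨ρ, f, g, hρ, hf, hg⟩ := exists_common_factor ι σ τ
  refine ⟨ρ, subst f a, subst g b, hρ, ?_⟩
  simp only [PolyadicHom.map_subst]
  exact ⟨subst_eq_subst_coe_subst hf _, subst_eq_subst_coe_subst hg _,
    subst_eq_subst_coe_subst hf _, subst_eq_subst_coe_subst hg _⟩

theorem subst_eq_subst_transfer (e : PolyadicHom I A (neatReduct ι B))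
    (k : PolyadicHom I A (neatReduct ι B')) (he : Function.Injective e)
    {σ τ : J → J} {a b : A} (h : subst σ (e a : B) = subst τ (e b : B)) :
    subst σ (k a : B') = subst τ (k b : B') := by
  obtain ⟨ρ, a', b', hρ, h₁, h₂, h₃, h₄⟩ := exists_common_subst e k σ τ a b
  rw [h₁, h₂] at h
  rw [h₃, h₄, he (subst_injective_of_injective_comp hρ h)]

/-- The subalgebra of the elements `s_σ a`, for `a` in a subalgebra of the neat reduct. -/
def substSubalgebra (e : PolyadicHom I A (neatReduct ι B)) : PolyadicSubalgebra J B where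
  carrier := {b | ∃ (σ : J → J) (a : A), subst σ (e a : B) = b}
  supClosed' := by
    rintro _ ⟨σ, a, rfl⟩ _ ⟨τ, b, rfl⟩
    obtain ⟨ρ, a', b', -, h₁, h₂, -⟩ := exists_common_subst e e σ τ a b
    exact ⟨ρ, a' ⊔ b', by rw [h₁, h₂, ← subst_sup, map_sup]; rfl⟩
  infClosed' := by
    rintro _ ⟨σ, a, rfl⟩ _ ⟨τ, b, rfl⟩
    obtain ⟨ρ, a', b', -, h₁, h₂, -⟩ := exists_common_subst e e σ τ a b
    exact ⟨ρ, a' ⊓ b', by rw [h₁, h₂, ← subst_inf, map_inf]; rfl⟩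
  compl_mem' := by
    rintro _ ⟨σ, a, rfl⟩
    exact ⟨σ, aᶜ, by rw [← subst_compl, map_compl']; rfl⟩
  bot_mem' := ⟨id, ⊥, by rw [map_bot]; exact subst_bot _⟩
  cyl_mem' := by
    rintro Γ _ ⟨σ, a, rfl⟩
    have : Infinite J := Infinite.of_injective ι ι.injective
    -- Replacing `σ` by a `ρ` one-to-one on `I` lets the cylindrification pass into `A`.
    obtain ⟨ρ, a', -, hρ, h₁, -⟩ := exists_common_subst e e σ σ a a
    exact ⟨ρ, cyl ((ρ ∘ ι) ⁻¹' Γ) a', by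
      rw [h₁, cyl_subst_of_injective_comp hρ, PolyadicHom.map_cyl]⟩
  subst_mem' := by
    rintro τ _ ⟨σ, a, rfl⟩
    exact ⟨τ ∘ σ, a, subst_comp _ _ _⟩

theorem exists_eq_subst {e : PolyadicHom I A (neatReduct ι B)}
    (hB : polyadicSg J (Set.range fun a => (e a : B)) = Set.univ) (b : B) :
    ∃ (σ : J → J) (a : A), subst σ (e a : B) = b := by
  have hb : b ∈ polyadicSg J (Set.range fun a => (e a : B)) := hB ▸ Set.mem_univ b
  refine hb (substSubalgebra e) ?_
  rintro _ ⟨a, rfl⟩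
  exact ⟨id, a, subst_id _⟩

/-- An algebra generated by a subalgebra `A` of its neat reduct embeds, over `A`, into every algebra
in the neat reduct of which `A` is embedded. -/
theorem exists_injective_hom_of_polyadicSg_eq_univ (e : PolyadicHom I A (neatReduct ι B))
    (k : PolyadicHom I A (neatReduct ι B')) (he : Function.Injective e)
    (hk : Function.Injective k)
    (hB : polyadicSg J (Set.range fun a => (e a : B)) = Set.univ) :
    ∃ h : PolyadicHom J B B', Function.Injective h ∧ ∀ a : A, h (e a : B) = (k a : B') := by
  choose s r hsr using exists_eq_subst hB
  let F : B → B' := fun b => subst (s b) (k (r b) : B')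
  -- The value does not depend on the chosen representation of the argument.
  have hF (σ : J → J) (a : A) : F (subst σ (e a : B)) = subst σ (k a : B') :=
    subst_eq_subst_transfer e k he (hsr _)
  have hpair (x y : B) : ∃ (ρ : J → J) (a b : A), Function.Injective (ρ ∘ ι) ∧
      x = subst ρ (e a : B) ∧ y = subst ρ (e b : B) := by
    obtain ⟨ρ, a, b, hρ, h₁, h₂, -⟩ := exists_common_subst e k (s x) (s y) (r x) (r y)
    exact ⟨ρ, a, b, hρ, (hsr x).symm.trans h₁, (hsr y).symm.trans h₂⟩
  have hJ : Infinite J := Infinite.of_injective ι ι.injective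
  refine ⟨⟨⟨⟨⟨F, ?_⟩, ?_⟩, ?_, ?_⟩, ?_, ?_⟩, ?_, ?_⟩
  · intro x y
    obtain ⟨ρ, a, b, -, rfl, rfl⟩ := hpair x y
    have hab : (e a : B) ⊔ e b = (e (a ⊔ b) : neatReduct ι B) := by rw [map_sup]; rfl
    rw [← subst_sup, hab, hF, hF, hF, ← subst_sup, map_sup]
    rfl
  · intro x y
    obtain ⟨ρ, a, b, -, rfl, rfl⟩ := hpair x y
    have hab : (e a : B) ⊓ e b = (e (a ⊓ b) : neatReduct ι B) := by rw [map_inf]; rfl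
    change F _ = F _ ⊓ F _
    rw [← subst_inf, hab, hF, hF, hF, ← subst_inf, map_inf]
    rfl
  · change F ⊤ = ⊤
    have h := hF id ⊤
    rw [map_top, map_top] at h
    exact (congrArg F (subst_top id).symm).trans (h.trans (subst_top id))
  · change F ⊥ = ⊥
    have h := hF id ⊥
    rw [map_bot, map_bot] at h
    exact (congrArg F (subst_bot id).symm).trans (h.trans (subst_bot id))
  · intro Γ x
    obtain ⟨ρ, a, -, hρ, rfl, -⟩ := hpair x x
    change F _ = cyl Γ (F _)
    rw [cyl_subst_of_injective_comp hρ, ← PolyadicHom.map_cyl, hF, hF,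
      cyl_subst_of_injective_comp hρ, PolyadicHom.map_cyl]
  · intro τ x
    obtain ⟨ρ, a, -, -, rfl, -⟩ := hpair x x
    change F _ = subst τ (F _)
    rw [← subst_comp, hF, hF, subst_comp]
  · intro x y hxy
    change F x = F y at hxy
    obtain ⟨ρ, a, b, hρ, rfl, rfl⟩ := hpair x y
    rw [hF, hF] at hxy
    rw [hk (subst_injective_of_injective_comp hρ hxy)]
  · intro a
    have h := hF id a
    rwa [subst_id, subst_id] at h

end Dilation

end PolyadicAlgebra

theorem mainTheorem7 {α β : Ordinal} (hα : Ordinal.omega0 ≤ α) (hαβ : α < β)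
    {A A' B B' : Type*}
    [BooleanAlgebra A] [BooleanAlgebra A'] [BooleanAlgebra B] [BooleanAlgebra B']
    [PolyadicAlgebra (Set.Iio α) A] [PolyadicAlgebra (Set.Iio α) A']
    [PolyadicAlgebra (Set.Iio β) B] [PolyadicAlgebra (Set.Iio β) B']
    (eA : PolyadicHom (Set.Iio α) A (neatReduct (ordinalIncl hαβ) B))
    (eA' : PolyadicHom (Set.Iio α) A' (neatReduct (ordinalIncl hαβ) B'))
    (heA : Function.Injective eA) (heA' : Function.Injective eA')
    (hB : polyadicSg (Set.Iio β) (Set.range fun a => (eA a : B)) = Set.univ)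
    (hB' : polyadicSg (Set.Iio β) (Set.range fun a => (eA' a : B')) = Set.univ)
    (i : PolyadicHom (Set.Iio α) A A') (hi : Function.Injective i) :
    ∃ ibar : PolyadicHom (Set.Iio β) B B',
      Function.Injective ibar ∧ ∀ a : A, ibar (eA a : B) = (eA' (i a) : B') := by
  have : Infinite (Set.Iio α) := by
    rw [Cardinal.infinite_iff, Cardinal.mk_Iio_ordinal, Cardinal.aleph0_le_lift]
    exact Ordinal.aleph0_le_card.2 hα
  have hk : Function.Injective (eA'.comp i) := heA'.comp hi
  -- Through `i`, `A` also sits in the neat reduct of `B'`.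
  exact PolyadicAlgebra.exists_injective_hom_of_polyadicSg_eq_univ eA (eA'.comp i) heA hk hB
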